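/- Let $S\subseteq\mathbb{R}^d$ be closed with nonzero, possibly infinite, Lebesgue measure, let $\Gamma$ be a finite index set, let $\phi_\gamma:\mathbb{R}^d\to\mathbb{R}$ ($\gamma\in\Gamma$) be Lebesgue measurable and let $u=(u_\gamma)_{\gamma\in\Gamma}$ be a vector of real numbers. A pdf is a Lebesgue measurable function on $\mathbb{R}^d$ that is nonnegative a.e. and has integral $1$; write $\mathbb{E}_\pi[f]=\int f\,\pi$ (with values in $[-\infty,+\infty]$ when it exists), $\mathrm{supp}(\pi)=\{x:\pi(x)\neq 0\}$ and $h(\pi)=-\mathbb{E}_\pi[\ln\pi]$ with $0\ln 0=0$. Inclusions between supports, equalities of pdfs and inequalities between functions are understood almost everywhere. Let $$\Omega(u)=\{\text{pdf }\pi:\ \mathrm{supp}(\pi)\subseteq S,\ \mathbb{E}_\pi[\phi_\gamma]\le u_\gamma\text{ for all }\gamma\in\Gamma\}.$$ Assume that there is $L\in\mathbb{R}$ with $\phi_\gamma\ge L$ for all $\gamma\in\Gamma$, that $\Omega(u)$ is nonempty, that $$C=\bigcap_{\gamma\in\Gamma}\{x\in S:\ \phi_\gamma(x)\le u_\gamma\}$$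 has nonzero Lebesgue measure, and that for some $\gamma_0\in\Gamma$ the function $\phi_{\gamma_0}$ is stable, i.e. $e^{-t\phi_{\gamma_0}}\in\mathcal{L}^1(\mathbb{R}^d)$ for every $t>0$. Then $\Omega(u)$ is convex, $h(\pi)$ exists in $[-\infty,+\infty]$ for every $\pi\in\Omega(u)$, and there is a unique $\pi_{ME}\in\Omega(u)$ with $h(\pi_{ME})=\max_{\pi\in\Omega(u)}h(\pi)$; moreover $h(\pi_{ME})\in\mathbb{R}$. Furthermore there are real numbers $\lambda_\gamma\ge 0$ ($\gamma\in\Gamma$) and $\alpha$ such that, with $S_{ME}=\mathrm{supp}(\pi_{ME})\subseteq S$, $$\pi_{ME}(x)=\mathbf{1}_{S_{ME}}(x)\exp\Big\{-\alpha-\sum_{\gamma\in\Gamma}\lambda_\gamma\phi_\gamma(x)\Big\}\quad\text{for a.e. }x,$$ where $\alpha=\ln\int_{S_{ME}}\exp\{-\sum_{\gamma}\lambda_\gamma\phi_\gamma(x)\}\,\mathrm{d}x$ with this integral finite; $\mathbb{E}_\pi[\mathbf{1}_{S\setminus S_{ME}}]=0$ for every $\pi\in\Omega(u)$ with $h(\pi)>-\infty$;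 $\sum_\gamma\lambda_\gamma(\mathbb{E}_{\pi_{ME}}[\phi_\gamma]-u_\gamma)=0$; and $$h(\pi_{ME})=\alpha+\sum_{\gamma\in\Gamma}\lambda_\gamma\mathbb{E}_{\pi_{ME}}[\phi_\gamma]=\alpha+\sum_{\gamma\in\Gamma}u_\gamma\lambda_\gamma.$$ -/

import Mathlib

open MeasureTheory

namespace Maxent

/-- `ℝ^d` with its Euclidean structure; `volume` on it is Lebesgue measure. -/
abbrev Space (d : ℕ) : Type := EuclideanSpace ℝ (Fin d)

/-- A probability density function on `ℝ^d`: Lebesgue measurable, non-negative almost everywhere,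
with integral one. (`Integrable` contains Lebesgue measurability.) -/
structure IsPdf {d : ℕ} (p : Space d → ℝ) : Prop where
  integrable : Integrable p volume
  nonneg : ∀ᵐ x ∂(volume : Measure (Space d)), 0 ≤ p x
  integral_eq_one : ∫ x, p x = 1

/-- The integral of the positive part of `f · p`. -/
noncomputable def posMean {d : ℕ} (p f : Space d → ℝ) : ENNReal :=
  ∫⁻ x, ENNReal.ofReal (f x * p x)

/-- The integral of the negative part of `f · p`. -/
noncomputable def negMean {d : ℕ} (p f : Space d → ℝ) : ENNReal :=
  ∫⁻ x, ENNReal.ofReal (-(f x * p x))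

/-- The expectation `∫ f · p` exists in `[-∞, +∞]`: it is not of the form `∞ - ∞`. -/
def MeanExists {d : ℕ} (p f : Space d → ℝ) : Prop :=
  posMean p f ≠ ⊤ ∨ negMean p f ≠ ⊤

/-- The expectation `E_p[f] = ∫ f · p`, with values in the extended reals
(meaningful when `MeanExists p f`). -/
noncomputable def mean {d : ℕ} (p f : Space d → ℝ) : EReal :=
  (posMean p f : EReal) - (negMean p f : EReal)

/-- The differential entropy of `p` exists in `[-∞, +∞]`. -/
def EntropyExists {d : ℕ} (p : Space d → ℝ) : Prop :=
  MeanExists p (fun x => Real.log (p x))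

/-- The differential entropy `h(p) = -E_p[ln p]`, with `0 · ln 0 = 0`
(meaningful when `EntropyExists p`). -/
noncomputable def entropy {d : ℕ} (p : Space d → ℝ) : EReal :=
  -mean p (fun x => Real.log (p x))

/-- `Ω(u)`: the pdfs supported (almost everywhere) in `S` whose moments satisfy
`E_p[φ γ] ≤ u γ` for every `γ`. -/
def momentClass {d : ℕ} {Γ : Type*} (S : Set (Space d)) (φ : Γ → Space d → ℝ) (u : Γ → ℝ) :
    Set (Space d → ℝ) :=
  {p | IsPdf p ∧ Function.support p ≤ᵐ[volume] S ∧
    ∀ γ, MeanExists p (φ γ) ∧ mean p (φ γ) ≤ (u γ : EReal)}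

/-- `f` is stable: measurable, and `exp (-t f)` is Lebesgue integrable on all of `ℝ^d`
for every `t > 0`. -/
def IsStable {d : ℕ} (f : Space d → ℝ) : Prop :=
  AEMeasurable f volume ∧ ∀ t : ℝ, 0 < t → Integrable (fun x => Real.exp (-t * f x)) volume

/-- `p` is the maximum entropy pdf of the convex collection `F`: it attains `max_{q ∈ F} h(q)`,
this maximum is not `-∞`, and `p` is, up to null sets, the only element of `F` attaining it. -/
structure IsMaxent {d : ℕ} (F : Set (Space d → ℝ)) (p : Space d → ℝ) : Prop where
  convex : Convex ℝ F
  mem : p ∈ F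
  bot_lt : ⊥ < entropy p
  entropyExists : ∀ q ∈ F, EntropyExists q
  le_entropy : ∀ q ∈ F, entropy q ≤ entropy p
  unique : ∀ q ∈ F, entropy q = entropy p → q =ᵐ[volume] p

/-- The exponential form of the maxent pdf of `Ω(u)` with multipliers `lam` and normalization
constant `α`; the set `S_ME` is `Function.support p`. -/
structure HasExponentialForm {d : ℕ} {Γ : Type*} [Fintype Γ] (S : Set (Space d))
    (φ : Γ → Space d → ℝ) (u : Γ → ℝ) (p : Space d → ℝ) (lam : Γ → ℝ) (α : ℝ) : Prop where
  form : p =ᵐ[volume] (Function.support p).indicator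
    (fun x => Real.exp (-α - ∑ γ, lam γ * φ γ x))
  support_subset : Function.support p ≤ᵐ[volume] S
  mean_compl_support : ∀ q ∈ momentClass S φ u, EntropyExists q → ⊥ < entropy q →
    mean q ((S \ Function.support p).indicator (fun _ => 1)) = 0
  integrableOn : IntegrableOn (fun x => Real.exp (-∑ γ, lam γ * φ γ x))
    (Function.support p) volume
  normalization : α = Real.log (∫ x in Function.support p, Real.exp (-∑ γ, lam γ * φ γ x))
  nonneg : ∀ γ, 0 ≤ lam γ
  slackness : ∑ γ, (lam γ : EReal) * (mean p (φ γ) - (u γ : EReal)) = 0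
  entropy_eq_mean : entropy p = (α : EReal) + ∑ γ, (lam γ : EReal) * mean p (φ γ)
  entropy_eq_bound : entropy p = ((α + ∑ γ, u γ * lam γ : ℝ) : EReal)

end Maxent

/-! Maximizing entropy means minimizing the strictly convex functional $\int p\ln p$ (`logMean`)
over a convex set. Since $\phi_\gamma\ge L$, every moment of a member of $\Omega(u)$ is an ordinary
finite integral; since $e^{-\phi_{\gamma_0}}$ is integrable, Young's inequality bounds $\int p\ln p$
below, so entropy always exists and is $<+\infty$. The set $C$ has finite measure by Markov's
inequality, and its uniform density gives a member with finite entropy.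

The gap in midpoint convexity of $x\ln x$ dominates a squared Hellinger distance, hence controls the
$L^1$ distance (`integral_abs_sub_le_midpoint_gap`). This makes minimizing sequences Cauchy in $L^1$
and the minimizer unique. The limit stays feasible by Fatou, and lower semicontinuity of $\int p\ln
p$ follows from Fatou for the relative entropy with respect to $e^{-t\phi_{\gamma_0}}$, letting
$t\to 0^+$; here stability for every $t$ enters.

Mixing in a little of a competitor shows that the minimizer $p$ vanishes only where all
finite-entropy competitors do. Perturbing to $p(1+\varepsilon g)$ with $g$ bounded gives a
first-order condition, linear in $g$. Farkas' lemma on the space of bounded measurable functions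
turns it into multipliers $\lambda_\gamma\ge0$ with $\ln p$ affine in the $\phi_\gamma$ on the
support; the remaining identities are integrals of this one. -/

namespace Maxent

open Filter Topology

/-! ### Farkas' lemma. -/

/-- **Farkas' lemma** for finitely many linear functionals on an arbitrary real vector space. -/
theorem farkas {ι V : Type*} [AddCommGroup V] [Module ℝ V] (s : Finset ι) :
    ∀ (F : ι → V →ₗ[ℝ] ℝ) (b : V →ₗ[ℝ] ℝ),
      (∀ x, (∀ i ∈ s, F i x ≤ 0) → b x ≤ 0) →
      ∃ c : ι → ℝ, (∀ i, 0 ≤ c i) ∧ ∀ x, b x = ∑ i ∈ s, c i * F i x := by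
  classical
  induction s using Finset.induction_on with
  | empty =>
    intro F b h
    refine ⟨0, fun _ => le_rfl, fun x => ?_⟩
    have h1 := h x (by simp)
    have h2 := h (-x) (by simp)
    rw [map_neg] at h2
    simp only [Finset.sum_empty]
    linarith
  | insert a s ha ih =>
    intro F b h
    by_cases hs : ∀ x, (∀ i ∈ s, F i x ≤ 0) → b x ≤ 0
    · obtain ⟨c, hc, hb⟩ := ih F b hs
      refine ⟨Function.update c a 0, fun i => ?_, fun x => ?_⟩
      · by_cases hi : i = a
        · subst hi; simp
        · simp [Function.update_of_ne hi, hc i]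
      · rw [Finset.sum_insert ha, hb x, Function.update_self, zero_mul, zero_add]
        refine Finset.sum_congr rfl fun i hi => ?_
        rw [Function.update_of_ne (fun e : i = a => ha (e ▸ hi))]
    · push Not at hs
      obtain ⟨x₁, hx₁, hbx₁⟩ := hs
      have hFa : 0 < F a x₁ := by
        by_contra hcon
        refine absurd (h x₁ fun i hi => ?_) (not_le.2 hbx₁)
        rcases Finset.mem_insert.1 hi with rfl | hi
        · exact not_lt.1 hcon
        · exact hx₁ i hi
      obtain ⟨x₀, hx₀, hb₀, hF₀⟩ : ∃ x₀, (∀ i ∈ s, F i x₀ ≤ 0) ∧ 0 < b x₀ ∧ F a x₀ = 1 := by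
        refine ⟨(F a x₁)⁻¹ • x₁, fun i hi => ?_, ?_, ?_⟩
        · rw [map_smul, smul_eq_mul]
          exact mul_nonpos_of_nonneg_of_nonpos (inv_nonneg.2 hFa.le) (hx₁ i hi)
        · rw [map_smul, smul_eq_mul]; positivity
        · rw [map_smul, smul_eq_mul, inv_mul_cancel₀ hFa.ne']
      -- The projection onto the kernel of `F a` along `x₀`. On its range the constraint `a` holds
      -- trivially, so the induction hypothesis applies to the functionals composed with `P`. The
      -- multiplier of `a` is then read off from $x = Px + F_a(x)\,x_0$.
      let P : V →ₗ[ℝ] V := LinearMap.id - (F a).smulRight x₀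
      have hP : ∀ x, P x = x - F a x • x₀ := fun x => by simp [P]
      obtain ⟨c, hc, hb⟩ := ih (fun i => (F i).comp P) (b.comp P) fun x hx => by
        refine h (P x) fun i hi => ?_
        rcases Finset.mem_insert.1 hi with rfl | hi
        · simp [hP, hF₀]
        · exact hx i hi
      have hk : 0 ≤ b x₀ - ∑ i ∈ s, c i * F i x₀ := by
        have : ∑ i ∈ s, c i * F i x₀ ≤ 0 :=
          Finset.sum_nonpos fun i hi => mul_nonpos_of_nonneg_of_nonpos (hc i) (hx₀ i hi)
        linarith
      refine ⟨Function.update c a (b x₀ - ∑ i ∈ s, c i * F i x₀), fun i => ?_, fun x => ?_⟩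
      · by_cases hi : i = a
        · subst hi; simpa using hk
        · simp [Function.update_of_ne hi, hc i]
      · rw [Finset.sum_insert ha, Function.update_self]
        have e : ∑ i ∈ s, Function.update c a (b x₀ - ∑ i ∈ s, c i * F i x₀) i * F i x
            = ∑ i ∈ s, c i * F i x :=
          Finset.sum_congr rfl fun i hi => by
            rw [Function.update_of_ne (fun e : i = a => ha (e ▸ hi))]
        have hbx := hb x
        simp only [LinearMap.comp_apply, hP, map_sub, map_smul, smul_eq_mul, mul_sub,
          Finset.sum_sub_distrib] at hbx
        have e2 : ∑ i ∈ s, c i * (F a x * F i x₀) = F a x * ∑ i ∈ s, c i * F i x₀ := by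
          rw [Finset.mul_sum]
          exact Finset.sum_congr rfl fun i _ => by ring
        rw [e]
        rw [e2] at hbx
        linarith

/-! ### Pointwise inequalities for $x\ln x$. -/

/-- Young's inequality for the relative entropy of two nonnegative numbers. -/
theorem sub_exp_le_log_mul {x : ℝ} (hx : 0 ≤ x) (y : ℝ) :
    x - Real.exp (-y) - y * x ≤ Real.log x * x := by
  rcases hx.eq_or_lt with rfl | hx
  · simpa using (Real.exp_pos _).le
  · have h := Real.add_one_le_exp (-y - Real.log x)
    rw [Real.exp_sub, Real.exp_log hx, le_div_iff₀ hx] at h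
    linarith

/-- The gap in the midpoint convexity of `x log x` dominates the squared Hellinger distance. -/
theorem hellinger_le_midpoint_gap {x y : ℝ} (hx : 0 ≤ x) (hy : 0 ≤ y) :
    (√x - √y) ^ 2 / 2 ≤ Real.log x * x + Real.log y * y
      - 2 * (Real.log ((x + y) / 2) * ((x + y) / 2)) := by
  rcases (add_nonneg hx hy).eq_or_lt with h0 | hpos
  · obtain rfl : x = 0 := by linarith
    obtain rfl : y = 0 := by linarith
    simp
  obtain ⟨a, ha, rfl⟩ : ∃ a, 0 ≤ a ∧ a ^ 2 = x := ⟨√x, Real.sqrt_nonneg _, Real.sq_sqrt hx⟩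
  obtain ⟨b, hb, rfl⟩ : ∃ b, 0 ≤ b ∧ b ^ 2 = y := ⟨√y, Real.sqrt_nonneg _, Real.sq_sqrt hy⟩
  obtain ⟨c, hc, hcm⟩ : ∃ c, 0 < c ∧ c ^ 2 = (a ^ 2 + b ^ 2) / 2 :=
    ⟨√((a ^ 2 + b ^ 2) / 2), Real.sqrt_pos.2 (by linarith), Real.sq_sqrt (by linarith)⟩
  rw [← hcm, Real.sqrt_sq ha, Real.sqrt_sq hb]
  -- This is $\ln(c/z)\le c/z-1$ multiplied by $2z^2$. Adding it at $z=a$ and $z=b$, where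
  -- $a^2+b^2=2c^2$, bounds the gap below by $4c^2-2c(a+b)$.
  have key : ∀ z, 0 ≤ z → 2 * z ^ 2 - 2 * (c * z) ≤
      Real.log (z ^ 2) * z ^ 2 - Real.log (c ^ 2) * z ^ 2 := by
    intro z hz
    rcases hz.eq_or_lt with rfl | hz
    · simp
    · have h := Real.log_le_sub_one_of_pos (div_pos hc hz)
      rw [Real.log_div hc.ne' hz.ne'] at h
      rw [Real.log_pow, Real.log_pow]
      have h2 : (Real.log c - Real.log z) * z ^ 2 ≤ (c / z - 1) * z ^ 2 :=
        mul_le_mul_of_nonneg_right h (sq_nonneg z)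
      have h3 : (c / z - 1) * z ^ 2 = c * z - z ^ 2 := by field_simp
      push_cast
      nlinarith
  have h1 := key a ha
  have h2 := key b hb
  have hab : a + b ≤ 2 * c := by
    refine le_of_sq_le_sq ?_ (by positivity)
    nlinarith [sq_nonneg (a - b)]
  have hgap : (a - b) ^ 2 / 2 ≤ 4 * c ^ 2 - 2 * c * (a + b) := by
    have : (2 * c - (a + b)) ^ 2 ≥ 0 := sq_nonneg _
    nlinarith
  have e : Real.log (c ^ 2) * a ^ 2 + Real.log (c ^ 2) * b ^ 2 = 2 * (Real.log (c ^ 2) * c ^ 2) := by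
    rw [hcm]; ring
  nlinarith

/-- Factor $|x-y|=|\sqrt x-\sqrt y|(\sqrt x+\sqrt y)$ and apply AM-GM with weight $\varepsilon$. The
bound is linear in the gap, so it can be integrated without Cauchy–Schwarz. -/
theorem abs_sub_le_midpoint_gap {x y ε : ℝ} (hx : 0 ≤ x) (hy : 0 ≤ y) (hε : 0 < ε) :
    |x - y| ≤ ε⁻¹ * (Real.log x * x + Real.log y * y
      - 2 * (Real.log ((x + y) / 2) * ((x + y) / 2))) + ε * (x + y) := by
  refine le_trans ?_ (add_le_add_left
    (mul_le_mul_of_nonneg_left (hellinger_le_midpoint_gap hx hy) (inv_pos.2 hε).le) _)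
  have e : x - y = (√x - √y) * (√x + √y) := by
    nlinarith [Real.sq_sqrt hx, Real.sq_sqrt hy]
  have e2 : (√x + √y) ^ 2 ≤ 2 * (x + y) := by
    nlinarith [Real.sq_sqrt hx, Real.sq_sqrt hy, sq_nonneg (√x - √y)]
  rw [e, abs_mul, abs_of_nonneg (a := √x + √y) (by positivity), ← sq_abs (√x - √y)]
  set d := |√x - √y|
  set w := √x + √y
  have h : 0 ≤ ε⁻¹ * (d - ε * w) ^ 2 := mul_nonneg (inv_pos.2 hε).le (sq_nonneg _)
  have h2 : ε⁻¹ * (d - ε * w) ^ 2 = ε⁻¹ * d ^ 2 - 2 * (d * w) + ε * w ^ 2 := by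
    field_simp; ring
  nlinarith

theorem log_mul_convex_comb_le {x y t : ℝ} (hx : 0 ≤ x) (hy : 0 ≤ y) (ht : 0 ≤ t) (ht1 : t ≤ 1) :
    Real.log ((1 - t) * x + t * y) * ((1 - t) * x + t * y)
      ≤ (1 - t) * (Real.log x * x) + t * (Real.log y * y) := by
  have := Real.convexOn_mul_log.2 hx hy (sub_nonneg.2 ht1) ht (by ring)
  simp only [smul_eq_mul] at this
  linarith

theorem log_one_add_mul_le {x : ℝ} (hx : -1 < x) :
    Real.log (1 + x) * (1 + x) ≤ x + x ^ 2 := by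
  have := Real.log_le_sub_one_of_pos (show 0 < 1 + x by linarith)
  nlinarith

/-! ### Limit theorems in $L^1$. -/

/-- **Fatou's lemma** for nonnegative integrable real functions with converging bounds. -/
theorem integrable_and_integral_le_of_tendsto {α : Type*} [MeasurableSpace α] {μ : Measure α}
    {f : ℕ → α → ℝ} {g : α → ℝ} {c : ℕ → ℝ} {C : ℝ} (hf : ∀ n, Integrable (f n) μ)
    (hnn : ∀ n, 0 ≤ᵐ[μ] f n) (hlim : ∀ᵐ x ∂μ, Tendsto (fun n => f n x) atTop (𝓝 (g x)))
    (hc : ∀ n, ∫ x, f n x ∂μ ≤ c n) (hcC : Tendsto c atTop (𝓝 C)) :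
    Integrable g μ ∧ ∫ x, g x ∂μ ≤ C := by
  have hgm : AEStronglyMeasurable g μ :=
    aestronglyMeasurable_of_tendsto_ae atTop (fun n => (hf n).aestronglyMeasurable) hlim
  have hgnn : 0 ≤ᵐ[μ] g := by
    filter_upwards [hlim, ae_all_iff.2 hnn] with x hx hn
    exact ge_of_tendsto' hx hn
  have hC : 0 ≤ C := ge_of_tendsto' hcC fun n => (integral_nonneg_of_ae (hnn n)).trans (hc n)
  have hle : ∫⁻ x, ENNReal.ofReal (g x) ∂μ ≤ ENNReal.ofReal C := by
    calc ∫⁻ x, ENNReal.ofReal (g x) ∂μ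
        = ∫⁻ x, liminf (fun n => ENNReal.ofReal (f n x)) atTop ∂μ := by
          refine lintegral_congr_ae ?_
          filter_upwards [hlim] with x hx
          exact ((ENNReal.continuous_ofReal.tendsto _).comp hx).liminf_eq.symm
      _ ≤ liminf (fun n => ∫⁻ x, ENNReal.ofReal (f n x) ∂μ) atTop :=
          lintegral_liminf_le' fun n => (hf n).aestronglyMeasurable.aemeasurable.ennreal_ofReal
      _ ≤ liminf (fun n => ENNReal.ofReal (c n)) atTop := by
          refine liminf_le_liminf (Eventually.of_forall fun n => ?_)
          rw [← ofReal_integral_eq_lintegral_ofReal (hf n) (hnn n)]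
          exact ENNReal.ofReal_le_ofReal (hc n)
      _ = ENNReal.ofReal C := ((ENNReal.continuous_ofReal.tendsto _).comp hcC).liminf_eq
  have hgi : Integrable g μ :=
    ⟨hgm, (hasFiniteIntegral_iff_ofReal hgnn).2 (hle.trans_lt ENNReal.ofReal_lt_top)⟩
  refine ⟨hgi, ?_⟩
  rw [← ofReal_integral_eq_lintegral_ofReal hgi hgnn] at hle
  exact (ENNReal.ofReal_le_ofReal_iff hC).1 hle

/-- Completeness of `L¹`, together with almost everywhere convergence along a subsequence. -/
theorem exists_tendsto_of_cauchy_L1 {α : Type*} [MeasurableSpace α] {μ : Measure α}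
    {f : ℕ → α → ℝ} (hf : ∀ n, Integrable (f n) μ)
    (hcau : ∀ ε > 0, ∃ N, ∀ m ≥ N, ∀ n ≥ N, ∫ x, |f m x - f n x| ∂μ ≤ ε) :
    ∃ (g : α → ℝ) (ns : ℕ → ℕ), StrictMono ns ∧ Integrable g μ ∧
      (∀ᵐ x ∂μ, Tendsto (fun k => f (ns k) x) atTop (𝓝 (g x))) ∧
      Tendsto (fun n => ∫ x, f n x ∂μ) atTop (𝓝 (∫ x, g x ∂μ)) := by
  have hdist : ∀ m n, dist ((hf m).toL1 (f m)) ((hf n).toL1 (f n)) = ∫ x, |f m x - f n x| ∂μ := by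
    intro m n
    rw [dist_eq_norm, ← Integrable.toL1_sub, L1.norm_eq_integral_norm]
    refine integral_congr_ae ?_
    filter_upwards [((hf m).sub (hf n)).coeFn_toL1] with x hx
    rw [hx, Real.norm_eq_abs, Pi.sub_apply]
  have hC : CauchySeq fun n => (hf n).toL1 (f n) := by
    refine Metric.cauchySeq_iff.2 fun ε hε => ?_
    obtain ⟨N, hN⟩ := hcau (ε / 2) (half_pos hε)
    exact ⟨N, fun m hm n hn => by rw [hdist]; linarith [hN m hm n hn]⟩
  obtain ⟨G, hG⟩ := cauchySeq_tendsto_of_complete hC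
  obtain ⟨ns, hns, hae⟩ := (tendstoInMeasure_of_tendsto_Lp hG).exists_seq_tendsto_ae
  refine ⟨G, ns, hns, L1.integrable_coeFn G, ?_, ?_⟩
  · filter_upwards [hae, ae_all_iff.2 fun n => (hf n).coeFn_toL1] with x hx he
    simpa only [he] using hx
  · have := (continuous_integral (G := ℝ) (m := _) (μ := μ)).tendsto G |>.comp hG
    refine this.congr fun n => ?_
    exact integral_congr_ae (hf n).coeFn_toL1

/-! ### From extended-valued means to integrals; convexity and a feasible density. -/

variable {d : ℕ} {Γ : Type*} {S : Set (Space d)} {φ : Γ → Space d → ℝ} {u : Γ → ℝ}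
  {p q f : Space d → ℝ}

/-- The integral `∫ p ln p`. -/
noncomputable def logMean (p : Space d → ℝ) : ℝ := ∫ x, Real.log (p x) * p x

theorem posMean_ne_top (h : Integrable (fun x => f x * p x)) : posMean p f ≠ ⊤ :=
  h.lintegral_lt_top.ne

theorem negMean_ne_top (h : Integrable (fun x => f x * p x)) : negMean p f ≠ ⊤ :=
  h.neg.lintegral_lt_top.ne

theorem mean_eq_integral (h : Integrable (fun x => f x * p x)) :
    mean p f = ((∫ x, f x * p x : ℝ) : EReal) := by
  have hn : ∫⁻ x, ENNReal.ofReal (-(f x * p x)) ≠ ⊤ := negMean_ne_top h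
  rw [integral_eq_lintegral_pos_part_sub_lintegral_neg_part h, EReal.coe_sub,
    EReal.coe_ennreal_toReal h.lintegral_lt_top.ne,
    EReal.coe_ennreal_toReal hn]
  rfl

theorem integrable_of_means_ne_top (hm : AEStronglyMeasurable (fun x => f x * p x))
    (h1 : posMean p f ≠ ⊤) (h2 : negMean p f ≠ ⊤) : Integrable (fun x => f x * p x) := by
  refine ⟨hm, ?_⟩
  have : ∫⁻ x, ‖f x * p x‖ₑ ≤ posMean p f + negMean p f := by
    rw [posMean, negMean, ← lintegral_add_left' hm.aemeasurable.ennreal_ofReal]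
    refine lintegral_mono fun x => ?_
    rw [Real.enorm_eq_ofReal_abs]
    rcases le_total 0 (f x * p x) with h | h
    · rw [abs_of_nonneg h]; exact le_self_add
    · rw [abs_of_nonpos h]; exact le_add_self
  exact this.trans_lt (ENNReal.add_lt_top.2 ⟨h1.lt_top, h2.lt_top⟩)

theorem mean_eq_top (h1 : posMean p f = ⊤) (h2 : negMean p f ≠ ⊤) : mean p f = ⊤ := by
  rw [mean, h1, EReal.coe_ennreal_top]
  exact EReal.top_sub (by simpa using h2)

/-- The lower bound $L$ makes the negative part of $\phi_\gamma p$ integrable, and the bound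
$u_\gamma$ then excludes the value $+\infty$. -/
theorem mem_momentClass_iff (hφ : ∀ γ, AEMeasurable (φ γ) volume) {L : ℝ}
    (hL : ∀ γ, ∀ᵐ x ∂(volume : Measure (Space d)), L ≤ φ γ x) :
    p ∈ momentClass S φ u ↔ IsPdf p ∧ (∀ᵐ x ∂(volume : Measure (Space d)), x ∉ S → p x = 0) ∧
      ∀ γ, Integrable (fun x => φ γ x * p x) ∧ ∫ x, φ γ x * p x ≤ u γ := by
  refine and_congr_right fun hp => and_congr ?_ (forall_congr' fun γ => ⟨fun h => ?_, fun h => ?_⟩)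
  · refine eventually_congr (Eventually.of_forall fun x => ?_)
    change (p x ≠ 0 → x ∈ S) ↔ _
    tauto
  · have hneg : negMean p (φ γ) ≠ ⊤ := by
      refine ((hp.integrable.const_mul |L|).lintegral_lt_top.trans_le' ?_).ne
      refine lintegral_mono_ae ?_
      filter_upwards [hL γ, hp.nonneg] with x hx hpx
      refine ENNReal.ofReal_le_ofReal ?_
      rw [← neg_mul]
      refine mul_le_mul_of_nonneg_right ?_ hpx
      linarith [neg_abs_le L]
    have hpos : posMean p (φ γ) ≠ ⊤ := fun htop => by
      have := h.2
      rw [mean_eq_top htop hneg] at this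
      exact absurd this (not_le.2 (EReal.coe_lt_top _))
    have hi := integrable_of_means_ne_top
      ((hφ γ).aestronglyMeasurable.mul hp.integrable.aestronglyMeasurable) hpos hneg
    refine ⟨hi, ?_⟩
    have := h.2
    rwa [mean_eq_integral hi, EReal.coe_le_coe_iff] at this
  · refine ⟨Or.inl (posMean_ne_top h.1), ?_⟩
    rw [mean_eq_integral h.1, EReal.coe_le_coe_iff]
    exact h.2

theorem aestronglyMeasurable_log_mul (hp : IsPdf p) :
    AEStronglyMeasurable (fun x => Real.log (p x) * p x) volume :=
  (Real.measurable_log.comp_aemeasurable hp.integrable.aestronglyMeasurable.aemeasurable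
    ).aestronglyMeasurable.mul hp.integrable.aestronglyMeasurable

/-- Young's inequality gives $-p\ln p\le e^{-f}+fp-p$, whose right side is integrable. Entropy
therefore exists, and can only fail to be finite by being $-\infty$. -/
theorem negMean_log_ne_top (hp : IsPdf p) (hfp : Integrable (fun x => f x * p x))
    (hf : Integrable (fun x => Real.exp (-f x))) :
    negMean p (fun x => Real.log (p x)) ≠ ⊤ := by
  refine (((hf.add hfp).sub hp.integrable).lintegral_lt_top.trans_le' ?_).ne
  refine lintegral_mono_ae ?_
  filter_upwards [hp.nonneg] with x hx
  refine ENNReal.ofReal_le_ofReal ?_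
  have := sub_exp_le_log_mul hx (f x)
  simp only [Pi.sub_apply, Pi.add_apply]
  linarith

theorem entropy_eq_neg_logMean (h : Integrable (fun x => Real.log (p x) * p x)) :
    entropy p = ((-logMean p : ℝ) : EReal) := by
  rw [entropy, mean_eq_integral h, logMean, EReal.coe_neg]

theorem entropy_eq_bot (hp : IsPdf p) (hneg : negMean p (fun x => Real.log (p x)) ≠ ⊤)
    (h : ¬ Integrable (fun x => Real.log (p x) * p x)) : entropy p = ⊥ := by
  have hpos : posMean p (fun x => Real.log (p x)) = ⊤ := by
    by_contra hne
    exact h (integrable_of_means_ne_top (aestronglyMeasurable_log_mul hp) hne hneg)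
  rw [entropy, mean_eq_top hpos hneg, EReal.neg_top]

theorem integrable_log_mul_of_le (hp : IsPdf p) (hfp : Integrable (fun x => f x * p x))
    (hf : Integrable (fun x => Real.exp (-f x))) {g : Space d → ℝ} (hg : Integrable g)
    (hle : ∀ᵐ x ∂(volume : Measure (Space d)), Real.log (p x) * p x ≤ g x) :
    Integrable (fun x => Real.log (p x) * p x) := by
  refine integrable_of_le_of_le (aestronglyMeasurable_log_mul hp) ?_ hle
    ((hp.integrable.sub hf).sub hfp) hg
  filter_upwards [hp.nonneg] with x hx
  exact sub_exp_le_log_mul hx (f x)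

theorem integral_relative_le_logMean (hp : IsPdf p) (hfp : Integrable (fun x => f x * p x))
    (hf : Integrable (fun x => Real.exp (-f x)))
    (h : Integrable (fun x => Real.log (p x) * p x)) :
    1 - (∫ x, Real.exp (-f x)) - ∫ x, f x * p x ≤ logMean p := by
  have h1 : ∫ x, (p x - Real.exp (-f x) - f x * p x) ≤ logMean p := by
    refine integral_mono_ae ((hp.integrable.sub hf).sub hfp) h ?_
    filter_upwards [hp.nonneg] with x hx
    exact sub_exp_le_log_mul hx (f x)
  have e1 := integral_sub (hp.integrable.sub hf) hfp
  simp only [Pi.sub_apply] at e1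
  rwa [e1, integral_sub hp.integrable hf, hp.integral_eq_one] at h1

theorem IsPdf.convex_comb (hp : IsPdf p) (hq : IsPdf q) {a b : ℝ} (ha : 0 ≤ a) (hb : 0 ≤ b)
    (hab : a + b = 1) : IsPdf (fun x => a * p x + b * q x) where
  integrable := (hp.integrable.const_mul a).add (hq.integrable.const_mul b)
  nonneg := by
    filter_upwards [hp.nonneg, hq.nonneg] with x hx hy
    positivity
  integral_eq_one := by
    rw [integral_add (hp.integrable.const_mul a) (hq.integrable.const_mul b),
      integral_const_mul, integral_const_mul, hp.integral_eq_one, hq.integral_eq_one]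
    simpa using hab

theorem convex_comb_mem_momentClass (hφ : ∀ γ, AEMeasurable (φ γ) volume) {L : ℝ}
    (hL : ∀ γ, ∀ᵐ x ∂(volume : Measure (Space d)), L ≤ φ γ x)
    (hp : p ∈ momentClass S φ u) (hq : q ∈ momentClass S φ u) {a b : ℝ} (ha : 0 ≤ a)
    (hb : 0 ≤ b) (hab : a + b = 1) : (fun x => a * p x + b * q x) ∈ momentClass S φ u := by
  rw [mem_momentClass_iff hφ hL] at hp hq ⊢
  refine ⟨hp.1.convex_comb hq.1 ha hb hab, ?_, fun γ => ?_⟩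
  · filter_upwards [hp.2.1, hq.2.1] with x hx hy hxS
    simp [hx hxS, hy hxS]
  · have hi1 := (hp.2.2 γ).1.const_mul a
    have hi2 := (hq.2.2 γ).1.const_mul b
    have e : (fun x => φ γ x * (a * p x + b * q x))
        = fun x => a * (φ γ x * p x) + b * (φ γ x * q x) := by ext x; ring
    rw [e]
    refine ⟨hi1.add hi2, ?_⟩
    rw [integral_add hi1 hi2, integral_const_mul, integral_const_mul]
    have h1 := mul_le_mul_of_nonneg_left (hp.2.2 γ).2 ha
    have h2 := mul_le_mul_of_nonneg_left (hq.2.2 γ).2 hb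
    have : a * u γ + b * u γ = u γ := by rw [← add_mul, hab, one_mul]
    linarith

/-- The uniform density on a set of finite positive measure. -/
theorem exists_uniform_mem_momentClass [Finite Γ] (hS : IsClosed S)
    (hφ : ∀ γ, AEMeasurable (φ γ) volume) {L : ℝ}
    (hL : ∀ γ, ∀ᵐ x ∂(volume : Measure (Space d)), L ≤ φ γ x)
    (hC : volume (⋂ γ, {x | x ∈ S ∧ φ γ x ≤ u γ}) ≠ 0) {γ₀ : Γ} (hst : IsStable (φ γ₀)) :
    ∃ p ∈ momentClass S φ u, Integrable (fun x => Real.log (p x) * p x) := by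
  set C : Set (Space d) := ⋂ γ, {x | x ∈ S ∧ φ γ x ≤ u γ} with hCdef
  have hCm : NullMeasurableSet C volume := by
    refine NullMeasurableSet.iInter fun γ => ?_
    exact hS.measurableSet.nullMeasurableSet.inter (nullMeasurableSet_le (hφ γ) aemeasurable_const)
  -- The $\phi_\gamma$ are only a.e. measurable, so $C$ is only null measurable; it is replaced by a
  -- measurable subset of full measure.
  obtain ⟨D, hDC, hDm, hD⟩ := hCm.exists_measurable_subset_ae_eq
  have hDφ : ∀ x ∈ D, ∀ γ, x ∈ S ∧ φ γ x ≤ u γ := fun x hx => by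
    simpa [hCdef] using hDC hx
  have hD0 : volume D ≠ 0 := by rwa [measure_congr hD]
  have hDtop : volume D ≠ ⊤ := by
    -- Markov's inequality: $e^{-\phi_{\gamma_0}}\ge e^{-u_{\gamma_0}}$ on $D$.
    have h1 := (hst.2 1 one_pos).measure_ge_lt_top (ε := Real.exp (-u γ₀)) (Real.exp_pos _)
    refine (h1.trans_le' (measure_mono fun x hx => ?_)).ne
    have := (hDφ x hx γ₀).2
    simpa using this
  set v : ℝ := volume.real D
  have hv : 0 < v := ENNReal.toReal_pos hD0 hDtop
  have hind : ∀ c : ℝ, Integrable (D.indicator fun _ => c) (volume : Measure (Space d)) :=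
    fun c => (integrable_indicator_iff hDm).2 (integrableOn_const hDtop)
  have hint : ∀ c : ℝ, ∫ x, D.indicator (fun _ => c) x = v * c := fun c => by
    rw [integral_indicator hDm, setIntegral_const, smul_eq_mul]
  have hpdf : IsPdf (D.indicator fun _ => v⁻¹) := by
    refine ⟨hind _, Eventually.of_forall fun x => ?_, ?_⟩
    · exact Set.indicator_nonneg (fun _ _ => (inv_pos.2 hv).le) x
    · rw [hint, mul_inv_cancel₀ hv.ne']
  refine ⟨D.indicator fun _ => v⁻¹, (mem_momentClass_iff hφ hL).2 ⟨hpdf, ?_, fun γ => ?_⟩, ?_⟩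
  · refine Eventually.of_forall fun x hx => Set.indicator_of_notMem (fun h => hx ?_) _
    exact (hDφ x h γ₀).1
  · have hle : ∀ x, φ γ x * D.indicator (fun _ => v⁻¹) x ≤ D.indicator (fun _ => u γ * v⁻¹) x := by
      intro x
      by_cases hx : x ∈ D
      · simp only [Set.indicator_of_mem hx]
        exact mul_le_mul_of_nonneg_right (hDφ x hx γ).2 (inv_pos.2 hv).le
      · simp [Set.indicator_of_notMem hx]
    have hi : Integrable (fun x => φ γ x * D.indicator (fun _ => v⁻¹) x) := by
      refine integrable_of_le_of_le
        ((hφ γ).aestronglyMeasurable.mul hpdf.integrable.aestronglyMeasurable) ?_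
        (Eventually.of_forall hle) (hind (L * v⁻¹)) (hind _)
      filter_upwards [hL γ] with x hx
      by_cases hxD : x ∈ D
      · simp only [Set.indicator_of_mem hxD]
        exact mul_le_mul_of_nonneg_right hx (inv_pos.2 hv).le
      · simp [Set.indicator_of_notMem hxD]
    refine ⟨hi, (integral_mono hi (hind _) hle).trans_eq ?_⟩
    rw [hint]; field_simp
  · have e : (fun x => Real.log (D.indicator (fun _ => v⁻¹) x) * D.indicator (fun _ => v⁻¹) x)
        = D.indicator fun _ => Real.log v⁻¹ * v⁻¹ := by
      ext x
      by_cases hx : x ∈ D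
      · simp only [Set.indicator_of_mem hx]
      · simp [Set.indicator_of_notMem hx]
    rw [e]
    exact hind _

/-! ### Existence of a minimizer. -/

/-- The midpoint gap of `∫ p ln p` controls the `L¹` distance. -/
theorem integral_abs_sub_le_midpoint_gap (hp : IsPdf p) (hq : IsPdf q)
    (hfp : Integrable (fun x => f x * p x)) (hfq : Integrable (fun x => f x * q x))
    (hf : Integrable (fun x => Real.exp (-f x)))
    (hp' : Integrable (fun x => Real.log (p x) * p x))
    (hq' : Integrable (fun x => Real.log (q x) * q x)) {ε : ℝ} (hε : 0 < ε) :
    Integrable (fun x => Real.log (1 / 2 * p x + 1 / 2 * q x) * (1 / 2 * p x + 1 / 2 * q x)) ∧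
    ∫ x, |p x - q x| ≤ ε⁻¹ * (logMean p + logMean q
      - 2 * logMean fun x => 1 / 2 * p x + 1 / 2 * q x) + 2 * ε := by
  have hm : IsPdf (fun x => 1 / 2 * p x + 1 / 2 * q x) :=
    hp.convex_comb hq (by norm_num) (by norm_num) (by norm_num)
  have hfm : Integrable (fun x => f x * (1 / 2 * p x + 1 / 2 * q x)) := by
    refine ((hfp.const_mul (1 / 2)).add (hfq.const_mul (1 / 2))).congr
      (Eventually.of_forall fun x => ?_)
    simp only [Pi.add_apply]; ring
  have hm' := integrable_log_mul_of_le hm hfm hf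
    ((hp'.const_mul (1 - 1 / 2)).add (hq'.const_mul (1 / 2))) (by
      filter_upwards [hp.nonneg, hq.nonneg] with x hx hy
      have := log_mul_convex_comb_le (t := 1 / 2) hx hy (by norm_num) (by norm_num)
      norm_num at this ⊢
      linarith)
  refine ⟨hm', ?_⟩
  have hi1 := ((hp'.add hq').sub (hm'.const_mul 2)).const_mul ε⁻¹
  have hi2 := (hp.integrable.add hq.integrable).const_mul ε
  have key : ∫ x, |p x - q x| ≤ ∫ x, (ε⁻¹ * (Real.log (p x) * p x + Real.log (q x) * q x
      - 2 * (Real.log (1 / 2 * p x + 1 / 2 * q x) * (1 / 2 * p x + 1 / 2 * q x)))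
      + ε * (p x + q x)) := by
    refine integral_mono_ae (hp.integrable.sub hq.integrable).abs (hi1.add hi2) ?_
    filter_upwards [hp.nonneg, hq.nonneg] with x hx hy
    have := abs_sub_le_midpoint_gap hx hy hε
    rwa [show (p x + q x) / 2 = 1 / 2 * p x + 1 / 2 * q x by ring] at this
  refine key.trans_eq ?_
  have e1 := integral_add hi1 hi2
  simp only [Pi.add_apply, Pi.sub_apply] at e1
  rw [e1, integral_const_mul, integral_const_mul]
  have e2 := integral_sub (hp'.add hq') (hm'.const_mul 2)
  have e3 := integral_add hp' hq'
  have e4 := integral_add hp.integrable hq.integrable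
  simp only [Pi.add_apply] at e2
  rw [e2, e3, e4, integral_const_mul, hp.integral_eq_one, hq.integral_eq_one]
  simp only [logMean]
  ring

theorem IsStable.integrable_exp_neg (hf : IsStable f) : Integrable (fun x => Real.exp (-f x)) := by
  simpa using hf.2 1 one_pos

/-- A minimizer of `∫ p ln p` over the densities in `Ω(u)` with finite entropy. -/
structure IsLogMeanMinimizer (S : Set (Space d)) (φ : Γ → Space d → ℝ) (u : Γ → ℝ)
    (p : Space d → ℝ) : Prop where
  mem : p ∈ momentClass S φ u
  integrable : Integrable (fun x => Real.log (p x) * p x)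
  le : ∀ q ∈ momentClass S φ u, Integrable (fun x => Real.log (q x) * q x) →
    logMean p ≤ logMean q

theorem exists_isLogMeanMinimizer (hφ : ∀ γ, AEMeasurable (φ γ) volume) {L : ℝ}
    (hL : ∀ γ, ∀ᵐ x ∂(volume : Measure (Space d)), L ≤ φ γ x) {γ₀ : Γ} (hst : IsStable (φ γ₀))
    (hne : ∃ p ∈ momentClass S φ u, Integrable (fun x => Real.log (p x) * p x)) :
    ∃ p, IsLogMeanMinimizer S φ u p := by
  have hexp := hst.integrable_exp_neg
  set K : Set (Space d → ℝ) :=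
    {p | p ∈ momentClass S φ u ∧ Integrable (fun x => Real.log (p x) * p x)} with hK
  have hKne : (logMean '' K).Nonempty := by
    obtain ⟨p, hp, hp'⟩ := hne
    exact ⟨_, p, ⟨hp, hp'⟩, rfl⟩
  have hKbdd : BddBelow (logMean '' K) := by
    refine ⟨1 - (∫ x, Real.exp (-φ γ₀ x)) - u γ₀, ?_⟩
    rintro _ ⟨p, ⟨hp, hp'⟩, rfl⟩
    have hp2 := (mem_momentClass_iff hφ hL).1 hp
    have := integral_relative_le_logMean hp2.1 (hp2.2.2 γ₀).1 hexp hp'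
    linarith [(hp2.2.2 γ₀).2]
  obtain ⟨a, -, ha, haK⟩ := exists_seq_tendsto_sInf hKne hKbdd
  set I := sInf (logMean '' K)
  choose P hPK hPa using haK
  have hP : ∀ n, IsPdf (P n) ∧ (∀ᵐ x ∂(volume : Measure (Space d)), x ∉ S → P n x = 0) ∧
      ∀ γ, Integrable (fun x => φ γ x * P n x) ∧ ∫ x, φ γ x * P n x ≤ u γ :=
    fun n => (mem_momentClass_iff hφ hL).1 (hPK n).1
  -- Midpoints are feasible, so their value is at least `I`. Two values within $\varepsilon^2/16$ of
  -- `I` leave a gap of at most $\varepsilon^2/8$, and the parameter $\varepsilon/4$ makes both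
  -- terms of the $L^1$ bound equal to $\varepsilon/2$.
  have hcau : ∀ ε > 0, ∃ N, ∀ m ≥ N, ∀ n ≥ N, ∫ x, |P m x - P n x| ≤ ε := by
    intro ε hε
    obtain ⟨N, hN⟩ := eventually_atTop.1 (ha.eventually (gt_mem_nhds (show I < I + ε ^ 2 / 16 from
      lt_add_of_pos_right _ (by positivity))))
    refine ⟨N, fun m hm n hn => ?_⟩
    obtain ⟨hi, hle⟩ := integral_abs_sub_le_midpoint_gap (hP m).1 (hP n).1 ((hP m).2.2 γ₀).1
      ((hP n).2.2 γ₀).1 hexp (hPK m).2 (hPK n).2 (show 0 < ε / 4 by positivity)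
    have hmid : I ≤ logMean fun x => 1 / 2 * P m x + 1 / 2 * P n x :=
      csInf_le hKbdd ⟨_, ⟨convex_comb_mem_momentClass hφ hL (hPK m).1 (hPK n).1
        (by norm_num) (by norm_num) (by norm_num), hi⟩, rfl⟩
    refine hle.trans ?_
    rw [hPa, hPa]
    have h1 := hN m hm
    have h2 := hN n hn
    have h3 : (ε / 4)⁻¹ * (a m + a n - 2 * logMean fun x => 1 / 2 * P m x + 1 / 2 * P n x)
        ≤ (ε / 4)⁻¹ * (ε ^ 2 / 8) :=
      mul_le_mul_of_nonneg_left (by linarith) (by positivity)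
    have h4 : (ε / 4)⁻¹ * (ε ^ 2 / 8) = ε / 2 := by field_simp; norm_num
    linarith
  obtain ⟨p, ns, hns, hpi, hae, hint⟩ :=
    exists_tendsto_of_cauchy_L1 (fun n => (hP n).1.integrable) hcau
  have hnn := ae_all_iff.2 fun n => (hP n).1.nonneg
  have hpdf : IsPdf p := by
    refine ⟨hpi, ?_, ?_⟩
    · filter_upwards [hae, hnn] with x hx hn
      exact ge_of_tendsto' hx fun k => hn _
    · refine tendsto_nhds_unique hint ?_
      simp only [(hP _).1.integral_eq_one]
      exact tendsto_const_nhds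
  have hmom : ∀ γ, Integrable (fun x => φ γ x * p x) ∧ ∫ x, φ γ x * p x ≤ u γ := by
    intro γ
    -- Subtracting `L` makes the integrand nonnegative, as Fatou requires.
    have hi : ∀ n, Integrable (fun x => φ γ x * P n x - L * P n x) := fun n =>
      ((hP n).2.2 γ).1.sub ((hP n).1.integrable.const_mul L)
    obtain ⟨h1, h2⟩ := integrable_and_integral_le_of_tendsto
      (f := fun k x => φ γ x * P (ns k) x - L * P (ns k) x)
      (g := fun x => φ γ x * p x - L * p x) (c := fun _ => u γ - L) (fun k => hi (ns k))
      (fun k => by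
        filter_upwards [hL γ, (hP (ns k)).1.nonneg] with x hx hy
        have := mul_le_mul_of_nonneg_right hx hy
        simpa using this)
      (by
        filter_upwards [hae] with x hx
        exact (hx.const_mul _).sub (hx.const_mul _))
      (fun k => by
        rw [integral_sub ((hP (ns k)).2.2 γ).1 ((hP (ns k)).1.integrable.const_mul L),
          integral_const_mul, (hP (ns k)).1.integral_eq_one]
        linarith [((hP (ns k)).2.2 γ).2])
      tendsto_const_nhds
    have h3 : Integrable (fun x => φ γ x * p x) := by
      refine (h1.add (hpi.const_mul L)).congr (Eventually.of_forall fun x => ?_)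
      simp
    refine ⟨h3, ?_⟩
    rw [integral_sub h3 (hpi.const_mul L), integral_const_mul, hpdf.integral_eq_one] at h2
    linarith
  have hmem : p ∈ momentClass S φ u := by
    refine (mem_momentClass_iff hφ hL).2 ⟨hpdf, ?_, hmom⟩
    filter_upwards [hae, ae_all_iff.2 fun n => (hP n).2.1] with x hx hn hxS
    refine tendsto_nhds_unique hx ?_
    simp only [hn _ hxS]
    exact tendsto_const_nhds
  -- Fatou is applied to $p\ln p+t\phi_{\gamma_0}p+e^{-t\phi_{\gamma_0}}-p\ge0$. The masses are all
  -- $1$, so the last two terms cancel in the limit; only the moment may drop, at a cost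
  -- proportional to $t$, which vanishes as $t\to0^+$.
  have hent : ∀ t > 0, Integrable (fun x => Real.log (p x) * p x) ∧
      logMean p ≤ I + t * (u γ₀ - ∫ x, φ γ₀ x * p x) := by
    intro t ht
    have hq : Integrable (fun x => Real.exp (-(t * φ γ₀ x))) := by
      simpa only [neg_mul] using hst.2 t ht
    have split : ∀ r : Space d → ℝ, Integrable r → Integrable (fun x => φ γ₀ x * r x) →
        Integrable (fun x => Real.log (r x) * r x) →
        Integrable (fun x => Real.log (r x) * r x
          + (t * (φ γ₀ x * r x) + (Real.exp (-(t * φ γ₀ x)) - r x))) ∧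
        ∫ x, (Real.log (r x) * r x + (t * (φ γ₀ x * r x) + (Real.exp (-(t * φ γ₀ x)) - r x)))
          = logMean r + (t * (∫ x, φ γ₀ x * r x)
            + ((∫ x, Real.exp (-(t * φ γ₀ x))) - ∫ x, r x)) := by
      intro r h1 h2 h3
      have i2 : Integrable (fun x => t * (φ γ₀ x * r x) + (Real.exp (-(t * φ γ₀ x)) - r x)) :=
        (h2.const_mul t).add (hq.sub h1)
      refine ⟨h3.add i2, ?_⟩
      have e := integral_add (h2.const_mul t) (hq.sub h1)
      simp only [Pi.sub_apply] at e
      rw [integral_add h3 i2, e, integral_sub hq h1, integral_const_mul, logMean]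
    obtain ⟨h1, h2⟩ := integrable_and_integral_le_of_tendsto
      (f := fun k x => Real.log (P (ns k) x) * P (ns k) x
        + (t * (φ γ₀ x * P (ns k) x) + (Real.exp (-(t * φ γ₀ x)) - P (ns k) x)))
      (g := fun x => Real.log (p x) * p x
        + (t * (φ γ₀ x * p x) + (Real.exp (-(t * φ γ₀ x)) - p x)))
      (c := fun k => a (ns k) + (t * u γ₀ + ((∫ x, Real.exp (-(t * φ γ₀ x))) - 1)))
      (fun k => (split _ (hP _).1.integrable ((hP _).2.2 γ₀).1 (hPK _).2).1)
      (fun k => by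
        filter_upwards [(hP (ns k)).1.nonneg] with x hx
        have := sub_exp_le_log_mul hx (t * φ γ₀ x)
        simp only [Pi.zero_apply]
        linarith)
      (by
        filter_upwards [hae] with x hx
        refine Tendsto.add ?_ (((hx.const_mul _).const_mul _).add (hx.const_sub _))
        have := (Real.continuous_mul_log.tendsto (p x)).comp hx
        simpa only [Function.comp_def, mul_comm] using this)
      (fun k => by
        rw [(split _ (hP _).1.integrable ((hP _).2.2 γ₀).1 (hPK _).2).2, hPa,
          (hP _).1.integral_eq_one]
        have := mul_le_mul_of_nonneg_left ((hP (ns k)).2.2 γ₀).2 ht.le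
        linarith)
      ((ha.comp hns.tendsto_atTop).add_const _)
    have h3 : Integrable (fun x => Real.log (p x) * p x) := by
      refine (h1.sub (((hmom γ₀).1.const_mul t).add (hq.sub hpi))).congr
        (Eventually.of_forall fun x => ?_)
      simp only [Pi.sub_apply, Pi.add_apply]
      ring
    refine ⟨h3, ?_⟩
    rw [(split p hpi (hmom γ₀).1 h3).2, hpdf.integral_eq_one] at h2
    linarith
  refine ⟨p, hmem, (hent 1 one_pos).1, fun q hq hq' => ?_⟩
  have hIq : I ≤ logMean q := csInf_le hKbdd ⟨q, ⟨hq, hq'⟩, rfl⟩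
  refine le_trans ?_ hIq
  have hlim : Tendsto (fun t : ℝ => I + t * (u γ₀ - ∫ x, φ γ₀ x * p x)) (𝓝[>] 0) (𝓝 I) := by
    have : Tendsto (fun t : ℝ => I + t * (u γ₀ - ∫ x, φ γ₀ x * p x)) (𝓝 0)
        (𝓝 (I + 0 * (u γ₀ - ∫ x, φ γ₀ x * p x))) := by
      apply Continuous.tendsto; fun_prop
    rw [zero_mul, add_zero] at this
    exact this.mono_left nhdsWithin_le_nhds
  refine ge_of_tendsto hlim ?_
  filter_upwards [self_mem_nhdsWithin] with t ht
  exact (hent t ht).2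

/-! ### Uniqueness and maximality of the support. -/

theorem IsLogMeanMinimizer.ae_eq (hφ : ∀ γ, AEMeasurable (φ γ) volume) {L : ℝ}
    (hL : ∀ γ, ∀ᵐ x ∂(volume : Measure (Space d)), L ≤ φ γ x) {γ₀ : Γ} (hst : IsStable (φ γ₀))
    (hp : IsLogMeanMinimizer S φ u p) (hq : q ∈ momentClass S φ u)
    (hq' : Integrable (fun x => Real.log (q x) * q x)) (heq : logMean q = logMean p) :
    q =ᵐ[volume] p := by
  have hp2 := (mem_momentClass_iff hφ hL).1 hp.mem
  have hq2 := (mem_momentClass_iff hφ hL).1 hq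
  have hle : ∀ ε > 0, ∫ x, |q x - p x| ≤ 0 + ε := by
    intro ε hε
    obtain ⟨hi, hle⟩ := integral_abs_sub_le_midpoint_gap hq2.1 hp2.1 (hq2.2.2 γ₀).1
      (hp2.2.2 γ₀).1 hst.integrable_exp_neg hq' hp.integrable (half_pos hε)
    have hmid := hp.le _ (convex_comb_mem_momentClass hφ hL hq hp.mem
        (by norm_num) (by norm_num) (by norm_num)) hi
    refine hle.trans ?_
    have : (ε / 2)⁻¹ * (logMean q + logMean p
        - 2 * logMean fun x => 1 / 2 * q x + 1 / 2 * p x) ≤ 0 :=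
      mul_nonpos_of_nonneg_of_nonpos (by positivity) (by linarith)
    linarith
  have h0 : ∫ x, |q x - p x| = 0 :=
    le_antisymm (le_of_forall_pos_le_add hle) (integral_nonneg fun x => abs_nonneg _)
  filter_upwards [(integral_eq_zero_iff_of_nonneg (fun x => abs_nonneg _)
    (hq2.1.integrable.sub hp2.1.integrable).abs).1 h0] with x hx
  exact sub_eq_zero.1 (abs_eq_zero.1 hx)

/-- The slope of $x\ln x$ at $0$ is $-\infty$. Mixing `q` into `p` with weight $t=e^{-s}$ gains
$tsk$, where $k$ is the mass of `q` on $\{p=0\}$, against a loss of at most $t$ times the difference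
of the two values. Minimality bounds $sk$ for all $s>0$, so $k=0$. -/
theorem IsLogMeanMinimizer.eq_zero_of_eq_zero (hφ : ∀ γ, AEMeasurable (φ γ) volume) {L : ℝ}
    (hL : ∀ γ, ∀ᵐ x ∂(volume : Measure (Space d)), L ≤ φ γ x) {γ₀ : Γ} (hst : IsStable (φ γ₀))
    (hp : IsLogMeanMinimizer S φ u p) (hq : q ∈ momentClass S φ u)
    (hq' : Integrable (fun x => Real.log (q x) * q x)) :
    ∀ᵐ x ∂(volume : Measure (Space d)), p x = 0 → q x = 0 := by
  have hp2 := (mem_momentClass_iff hφ hL).1 hp.mem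
  have hq2 := (mem_momentClass_iff hφ hL).1 hq
  set A : Set (Space d) := p ⁻¹' {0} with hA
  have hAm : NullMeasurableSet A volume :=
    hp2.1.integrable.aestronglyMeasurable.aemeasurable.nullMeasurable (measurableSet_singleton 0)
  have hki : Integrable (A.indicator q) := hq2.1.integrable.indicator₀ hAm
  set k := ∫ x, A.indicator q x with hk
  have hnn : 0 ≤ᵐ[volume] A.indicator q := by
    filter_upwards [hq2.1.nonneg] with x hx
    exact Set.indicator_apply_nonneg fun _ => hx
  have hk0 : 0 ≤ k := integral_nonneg_of_ae hnn
  have key : ∀ s > 0, s * k ≤ logMean q - logMean p := by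
    intro s hs
    set t := Real.exp (-s) with ht
    have ht0 : 0 < t := Real.exp_pos _
    have ht1 : t ≤ 1 := Real.exp_le_one_iff.2 (by linarith)
    have hmem := convex_comb_mem_momentClass hφ hL hp.mem hq (sub_nonneg.2 ht1) ht0.le (by ring)
    have hm2 := (mem_momentClass_iff hφ hL).1 hmem
    have i1 := (hp.integrable.const_mul (1 - t)).add (hq'.const_mul t)
    have i2 := hki.const_mul (t * -s)
    have hle : ∀ᵐ x ∂(volume : Measure (Space d)),
        Real.log ((1 - t) * p x + t * q x) * ((1 - t) * p x + t * q x)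
          ≤ ((1 - t) * (Real.log (p x) * p x) + t * (Real.log (q x) * q x))
            + t * -s * A.indicator q x := by
      filter_upwards [hp2.1.nonneg, hq2.1.nonneg] with x hx hy
      by_cases hpx : p x = 0
      · rw [Set.indicator_of_mem (show x ∈ A from hpx), hpx]
        rcases hy.eq_or_lt with h0 | hpos
        · simp [← h0]
        · simp only [mul_zero, zero_add]
          rw [Real.log_mul ht0.ne' hpos.ne', ht, Real.log_exp]
          refine le_of_eq ?_
          ring
      · rw [Set.indicator_of_notMem (show x ∉ A from hpx), mul_zero, add_zero]
        exact log_mul_convex_comb_le hx hy ht0.le ht1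
    have hi := integrable_log_mul_of_le hm2.1 (hm2.2.2 γ₀).1 hst.integrable_exp_neg (i1.add i2) hle
    have h1 := hp.le _ hmem hi
    have h2 := integral_mono_ae hi (i1.add i2) hle
    have e1 := integral_add i1 i2
    have e2 := integral_add (hp.integrable.const_mul (1 - t)) (hq'.const_mul t)
    simp only [Pi.add_apply] at e1 e2 h2
    rw [e1, e2, integral_const_mul, integral_const_mul, integral_const_mul] at h2
    have h3 : t * (s * k) ≤ t * (logMean q - logMean p) := by
      simp only [logMean] at h1 ⊢
      nlinarith
    exact le_of_mul_le_mul_left h3 ht0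
  have hkz : k = 0 := by
    by_contra hne
    have hkpos : 0 < k := lt_of_le_of_ne hk0 (Ne.symm hne)
    have hd := hp.le q hq hq'
    have := key ((logMean q - logMean p + 1) / k) (by
      apply div_pos _ hkpos; linarith)
    rw [div_mul_cancel₀ _ hne] at this
    linarith
  rw [hk, integral_eq_zero_iff_of_nonneg_ae hnn hki] at hkz
  filter_upwards [hkz] with x hx hpx
  rwa [Set.indicator_of_mem (show x ∈ A from hpx)] at hx

/-! ### First variation and Lagrange multipliers. -/

/-- First variation: the minimizer does not decrease along bounded admissible perturbations. -/
theorem IsLogMeanMinimizer.variation_nonneg [Finite Γ] (hφ : ∀ γ, AEMeasurable (φ γ) volume) {L : ℝ}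
    (hL : ∀ γ, ∀ᵐ x ∂(volume : Measure (Space d)), L ≤ φ γ x) {γ₀ : Γ} (hst : IsStable (φ γ₀))
    (hp : IsLogMeanMinimizer S φ u p) {g : Space d → ℝ} (hg : Measurable g) {M : ℝ}
    (hM : ∀ x, |g x| ≤ M) (hg0 : ∫ x, g x * p x = 0)
    (hgφ : ∀ γ, ∫ x, φ γ x * p x = u γ → ∫ x, g x * (φ γ x * p x) ≤ 0) :
    0 ≤ ∫ x, g x * (Real.log (p x) * p x) := by
  have hp2 := (mem_momentClass_iff hφ hL).1 hp.mem
  have hbdd : ∀ {w : Space d → ℝ}, Integrable w → Integrable (fun x => g x * w x) := fun hw =>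
    hw.bdd_mul hg.aestronglyMeasurable (Eventually.of_forall hM)
  -- Active constraints hold by the sign hypothesis on `g`; inactive ones have slack, which survives
  -- for small $\varepsilon$.
  have hev : ∀ᶠ ε : ℝ in 𝓝[>] 0, ∀ γ,
      (∫ x, φ γ x * p x) + ε * ∫ x, g x * (φ γ x * p x) ≤ u γ := by
    refine eventually_all.2 fun γ => ?_
    rcases (hp2.2.2 γ).2.eq_or_lt with h | h
    · filter_upwards [self_mem_nhdsWithin] with ε hε
      have : ε * ∫ x, g x * (φ γ x * p x) ≤ 0 :=
        mul_nonpos_of_nonneg_of_nonpos (le_of_lt hε) (hgφ γ h)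
      linarith
    · have hlim : Tendsto (fun ε : ℝ => (∫ x, φ γ x * p x) + ε * ∫ x, g x * (φ γ x * p x)) (𝓝 0)
          (𝓝 ((∫ x, φ γ x * p x) + 0 * ∫ x, g x * (φ γ x * p x))) := by
        apply Continuous.tendsto; fun_prop
      rw [zero_mul, add_zero] at hlim
      exact (hlim.mono_left nhdsWithin_le_nhds).eventually (ge_mem_nhds h)
  have hsmall : ∀ᶠ ε : ℝ in 𝓝[>] 0, ε * M < 1 := by
    have hlim : Tendsto (fun ε : ℝ => ε * M) (𝓝 0) (𝓝 (0 * M)) := by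
      apply Continuous.tendsto; fun_prop
    rw [zero_mul] at hlim
    exact (hlim.mono_left nhdsWithin_le_nhds).eventually (gt_mem_nhds one_pos)
  -- Minimality against $p(1+\varepsilon g)$, divided by $\varepsilon$; the remainder comes from
  -- $(1+x)\ln(1+x)\le x+x^2$ at $x=\varepsilon g$.
  have hineq : ∀ᶠ ε : ℝ in 𝓝[>] 0, 0 ≤ (∫ x, g x * (Real.log (p x) * p x)) + ε * M ^ 2 := by
    filter_upwards [hev, hsmall, self_mem_nhdsWithin] with ε hε hεM hε0
    replace hε0 : 0 < ε := hε0
    have hlt : ∀ x, |ε * g x| < 1 := fun x => by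
      rw [abs_mul, abs_of_pos hε0]
      exact (mul_le_mul_of_nonneg_left (hM x) hε0.le).trans_lt hεM
    have hgp := hbdd hp2.1.integrable
    have hpdf : IsPdf (fun x => p x + ε * (g x * p x)) := by
      refine ⟨hp2.1.integrable.add (hgp.const_mul ε), ?_, ?_⟩
      · filter_upwards [hp2.1.nonneg] with x hx
        have := mul_nonneg (by linarith [(abs_lt.1 (hlt x)).1] : 0 ≤ 1 + ε * g x) hx
        linarith
      · rw [integral_add hp2.1.integrable (hgp.const_mul ε), integral_const_mul, hg0,
          hp2.1.integral_eq_one]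
        simp
    have hmem : (fun x => p x + ε * (g x * p x)) ∈ momentClass S φ u := by
      refine (mem_momentClass_iff hφ hL).2 ⟨hpdf, ?_, fun γ => ?_⟩
      · filter_upwards [hp2.2.1] with x hx hxS
        simp [hx hxS]
      · have e : (fun x => φ γ x * (p x + ε * (g x * p x)))
            = fun x => φ γ x * p x + ε * (g x * (φ γ x * p x)) := by ext x; ring
        have hi := (hbdd (hp2.2.2 γ).1).const_mul ε
        rw [e]
        refine ⟨(hp2.2.2 γ).1.add hi, ?_⟩
        rw [integral_add (hp2.2.2 γ).1 hi, integral_const_mul]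
        exact hε γ
    have i1 := hp.integrable.add ((hbdd hp.integrable).const_mul ε)
    have i2 := (hgp.const_mul ε).add (hp2.1.integrable.const_mul (ε ^ 2 * M ^ 2))
    have hle : ∀ᵐ x ∂(volume : Measure (Space d)),
        Real.log (p x + ε * (g x * p x)) * (p x + ε * (g x * p x))
          ≤ (Real.log (p x) * p x + ε * (g x * (Real.log (p x) * p x)))
            + (ε * (g x * p x) + ε ^ 2 * M ^ 2 * p x) := by
      filter_upwards [hp2.1.nonneg] with x hx
      rcases hx.eq_or_lt with h0 | hpos
      · simp [← h0]
      · have h1 : 0 < 1 + ε * g x := by linarith [(abs_lt.1 (hlt x)).1]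
        have h2 := log_one_add_mul_le (x := ε * g x) (by linarith)
        have h3 : (ε * g x) ^ 2 ≤ ε ^ 2 * M ^ 2 := by
          rw [mul_pow]
          exact mul_le_mul_of_nonneg_left (sq_le_sq' (abs_le.1 (hM x)).1 (abs_le.1 (hM x)).2)
            (sq_nonneg ε)
        have h4 := mul_le_mul_of_nonneg_right (h2.trans (add_le_add_right h3 _)) hx
        rw [show p x + ε * (g x * p x) = p x * (1 + ε * g x) by ring,
          Real.log_mul hpos.ne' h1.ne']
        linarith
    have hi := integrable_log_mul_of_le hpdf
      ((mem_momentClass_iff hφ hL).1 hmem |>.2.2 γ₀).1 hst.integrable_exp_neg (i1.add i2) hle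
    have h1 := hp.le _ hmem hi
    have h2 := integral_mono_ae hi (i1.add i2) hle
    have e1 := integral_add i1 i2
    have e2 := integral_add hp.integrable ((hbdd hp.integrable).const_mul ε)
    have e3 := integral_add (hgp.const_mul ε) (hp2.1.integrable.const_mul (ε ^ 2 * M ^ 2))
    simp only [Pi.add_apply] at e1 e2 e3 h2
    rw [e1, e2, e3, integral_const_mul, integral_const_mul, integral_const_mul, hg0,
      hp2.1.integral_eq_one] at h2
    simp only [logMean] at h1
    refine le_of_mul_le_mul_left (a := ε) ?_ hε0
    linarith
  have hlim : Tendsto (fun ε : ℝ => (∫ x, g x * (Real.log (p x) * p x)) + ε * M ^ 2) (𝓝[>] 0)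
      (𝓝 (∫ x, g x * (Real.log (p x) * p x))) := by
    have : Tendsto (fun ε : ℝ => (∫ x, g x * (Real.log (p x) * p x)) + ε * M ^ 2) (𝓝 0)
        (𝓝 ((∫ x, g x * (Real.log (p x) * p x)) + 0 * M ^ 2)) := by
      apply Continuous.tendsto; fun_prop
    rw [zero_mul, add_zero] at this
    exact this.mono_left nhdsWithin_le_nhds
  exact ge_of_tendsto hlim hineq

/-- The vector space of bounded measurable functions. -/
def boundedMeasurable (d : ℕ) : Submodule ℝ (Space d → ℝ) where
  carrier := {g | Measurable g ∧ ∃ M, ∀ x, |g x| ≤ M}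
  zero_mem' := ⟨measurable_const, 0, fun x => by simp⟩
  add_mem' := by
    rintro f g ⟨hf, M, hM⟩ ⟨hg, N, hN⟩
    exact ⟨hf.add hg, M + N, fun x => (abs_add_le _ _).trans (add_le_add (hM x) (hN x))⟩
  smul_mem' := by
    rintro c f ⟨hf, M, hM⟩
    refine ⟨hf.const_smul c, |c| * M, fun x => ?_⟩
    rw [Pi.smul_apply, smul_eq_mul, abs_mul]
    exact mul_le_mul_of_nonneg_left (hM x) (abs_nonneg c)

theorem integrable_boundedMeasurable_mul (g : boundedMeasurable d) {w : Space d → ℝ}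
    (hw : Integrable w) : Integrable (fun x => g.1 x * w x) := by
  obtain ⟨hg, M, hM⟩ := g.2
  exact hw.bdd_mul hg.aestronglyMeasurable (Eventually.of_forall hM)

/-- Integration of bounded measurable functions against an integrable one. -/
noncomputable def integralAgainst (w : Space d → ℝ) (hw : Integrable w) :
    boundedMeasurable d →ₗ[ℝ] ℝ where
  toFun g := ∫ x, g.1 x * w x
  map_add' f g := by
    rw [← integral_add (integrable_boundedMeasurable_mul f hw)
      (integrable_boundedMeasurable_mul g hw)]
    refine integral_congr_ae (Eventually.of_forall fun x => ?_)
    simp [add_mul]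
  map_smul' c g := by
    rw [RingHom.id_apply, smul_eq_mul, ← integral_const_mul]
    refine integral_congr_ae (Eventually.of_forall fun x => ?_)
    simp [mul_assoc]

theorem ae_eq_zero_of_integralAgainst_eq_zero {w : Space d → ℝ} (hw : Integrable w)
    (h : ∀ g : boundedMeasurable d, ∫ x, g.1 x * w x = 0) : w =ᵐ[volume] 0 := by
  refine hw.ae_eq_zero_of_forall_setIntegral_eq_zero fun s hs _ => ?_
  have := h ⟨s.indicator fun _ => 1, measurable_const.indicator hs, 1, fun x => by
    by_cases hx : x ∈ s <;> simp [hx]⟩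
  rw [← integral_indicator hs, ← this]
  refine integral_congr_ae (Eventually.of_forall fun x => ?_)
  by_cases hx : x ∈ s <;> simp [hx]

/-- Farkas' lemma for the functionals $g\mapsto\int g(\phi_\gamma-E_\gamma)p$ of the active
constraints. Centring at $E_\gamma$ makes them vanish on constants, which absorbs the normalization
constraint. The resulting identity, valid for every bounded `g`, holds pointwise a.e. after division
by `p`. -/
theorem IsLogMeanMinimizer.exists_multipliers [Fintype Γ] (hφ : ∀ γ, AEMeasurable (φ γ) volume)
    {L : ℝ} (hL : ∀ γ, ∀ᵐ x ∂(volume : Measure (Space d)), L ≤ φ γ x) {γ₀ : Γ}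
    (hst : IsStable (φ γ₀)) (hp : IsLogMeanMinimizer S φ u p) :
    ∃ lam : Γ → ℝ, (∀ γ, 0 ≤ lam γ) ∧
      (∀ γ, lam γ = 0 ∨ ∫ x, φ γ x * p x = u γ) ∧
      ∀ᵐ x ∂(volume : Measure (Space d)), p x ≠ 0 →
        Real.log (p x) = logMean p - ∑ γ, lam γ * (φ γ x - ∫ y, φ γ y * p y) := by
  classical
  have hp2 := (mem_momentClass_iff hφ hL).1 hp.mem
  set E : Γ → ℝ := fun γ => ∫ y, φ γ y * p y with hE
  have hw : ∀ γ, Integrable (fun x => φ γ x * p x - E γ * p x) := fun γ =>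
    (hp2.2.2 γ).1.sub (hp2.1.integrable.const_mul _)
  have hb : Integrable (fun x => logMean p * p x - Real.log (p x) * p x) :=
    (hp2.1.integrable.const_mul _).sub hp.integrable
  let F : Γ → boundedMeasurable d →ₗ[ℝ] ℝ := fun γ =>
    if E γ = u γ then integralAgainst _ (hw γ) else 0
  obtain ⟨c, hc, hcb⟩ := farkas Finset.univ F (integralAgainst _ hb) fun g hg => by
    obtain ⟨hgm, M, hM⟩ := g.2
    set a : ℝ := ∫ x, g.1 x * p x with ha
    have hgw : ∀ {w : Space d → ℝ}, Integrable w → Integrable (fun x => g.1 x * w x) :=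
      fun hw => integrable_boundedMeasurable_mul g hw
    have expand : ∀ {w : Space d → ℝ}, Integrable w →
        ∫ x, (g.1 x - a) * w x = (∫ x, g.1 x * w x) - a * ∫ x, w x := fun {w} hw => by
      rw [← integral_const_mul, ← integral_sub (hgw hw) (hw.const_mul a)]
      refine integral_congr_ae (Eventually.of_forall fun x => ?_)
      ring
    have expand2 : ∀ {w : Space d → ℝ} (k : ℝ), Integrable w →
        ∫ x, g.1 x * (w x - k * p x) = (∫ x, g.1 x * w x) - k * a := fun {w} k hw => by
      rw [ha, ← integral_const_mul, ← integral_sub (hgw hw) ((hgw hp2.1.integrable).const_mul k)]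
      refine integral_congr_ae (Eventually.of_forall fun x => ?_)
      ring
    -- Only perturbations with $\int gp=0$ are admissible, so the mean `a` is subtracted from `g`.
    have hvar := hp.variation_nonneg hφ hL hst (g := fun x => g.1 x - a)
      (hgm.sub measurable_const) (M := M + |a|)
      (fun x => (abs_sub _ _).trans (add_le_add_left (hM x) _))
      (by rw [expand hp2.1.integrable, hp2.1.integral_eq_one, mul_one, ← ha, sub_self])
      (fun γ hγ => by
        have h1 : F γ g ≤ 0 := hg γ (Finset.mem_univ γ)
        have h2 : F γ g = ∫ x, g.1 x * (φ γ x * p x - E γ * p x) := by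
          simp only [F, hE, if_pos hγ]
          rfl
        rw [h2, expand2 (E γ) (hp2.2.2 γ).1] at h1
        rw [expand (hp2.2.2 γ).1]
        change _ - a * E γ ≤ 0
        linarith)
    rw [expand hp.integrable] at hvar
    have h3 : integralAgainst _ hb g = -∫ x, g.1 x * (Real.log (p x) * p x - logMean p * p x) := by
      rw [← integral_neg]
      refine integral_congr_ae (Eventually.of_forall fun x => ?_)
      simp only
      ring
    rw [h3, expand2 (logMean p) hp.integrable]
    change 0 ≤ _ - a * logMean p at hvar
    linarith
  -- Inactive constraints entered as the zero functional, so Farkas leaves their coefficients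
  -- arbitrary; they are reset to $0$ for complementary slackness.
  refine ⟨fun γ => if E γ = u γ then c γ else 0, fun γ => ?_, fun γ => ?_, ?_⟩
  · dsimp only
    split_ifs
    exacts [hc γ, le_rfl]
  · by_cases h : E γ = u γ
    · exact Or.inr h
    · exact Or.inl (if_neg h)
  · have hsum : Integrable (fun x => ∑ γ, (if E γ = u γ then c γ else 0)
        * (φ γ x * p x - E γ * p x)) :=
      integrable_finsetSum _ fun γ _ => (hw γ).const_mul _
    have hz := ae_eq_zero_of_integralAgainst_eq_zero (hb.sub hsum) fun g => by
      have h1 := hcb g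
      have h2 : ∫ x, g.1 x * ∑ γ, (if E γ = u γ then c γ else 0) * (φ γ x * p x - E γ * p x)
          = ∑ γ, c γ * F γ g := by
        simp only [Finset.mul_sum]
        rw [integral_finsetSum]
        · refine Finset.sum_congr rfl fun γ _ => ?_
          by_cases h : E γ = u γ
          · simp only [F, if_pos h]
            change _ = c γ * ∫ x, g.1 x * (φ γ x * p x - E γ * p x)
            rw [← integral_const_mul]
            refine integral_congr_ae (Eventually.of_forall fun x => ?_)
            simp only
            ring
          · simp [F, if_neg h]
        · exact fun γ _ => integrable_boundedMeasurable_mul g ((hw γ).const_mul _)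
      have h3 : ∫ x, g.1 x * (logMean p * p x - Real.log (p x) * p x) = ∑ γ, c γ * F γ g := h1
      have h4 := integral_sub (integrable_boundedMeasurable_mul g hb)
        (integrable_boundedMeasurable_mul g hsum)
      rw [h2, h3, sub_self] at h4
      refine Eq.trans ?_ h4
      refine integral_congr_ae (Eventually.of_forall fun x => ?_)
      simp only [Pi.sub_apply]
      ring
    filter_upwards [hz] with x hx hpx
    simp only [Pi.sub_apply, Pi.zero_apply] at hx
    have e : ∑ γ, (if E γ = u γ then c γ else 0) * (φ γ x * p x - E γ * p x)
        = (∑ γ, (if E γ = u γ then c γ else 0) * (φ γ x - E γ)) * p x := by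
      rw [Finset.sum_mul]
      exact Finset.sum_congr rfl fun γ _ => by ring
    rw [e, ← sub_mul, ← sub_mul] at hx
    have := (mul_eq_zero.1 hx).resolve_right hpx
    linarith

/-! ### Maximum entropy and the exponential form. -/

theorem IsLogMeanMinimizer.entropy_eq (hp : IsLogMeanMinimizer S φ u p) :
    entropy p = ((-logMean p : ℝ) : EReal) := entropy_eq_neg_logMean hp.integrable

/-- Members of $\Omega(u)$ with $p\ln p$ not integrable have entropy $-\infty$, so they neither beat
nor tie with the minimizer of `logMean`. -/
theorem IsLogMeanMinimizer.isMaxent (hφ : ∀ γ, AEMeasurable (φ γ) volume) {L : ℝ}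
    (hL : ∀ γ, ∀ᵐ x ∂(volume : Measure (Space d)), L ≤ φ γ x) {γ₀ : Γ} (hst : IsStable (φ γ₀))
    (hp : IsLogMeanMinimizer S φ u p) : IsMaxent (momentClass S φ u) p := by
  have hneg : ∀ q ∈ momentClass S φ u, IsPdf q ∧ negMean q (fun x => Real.log (q x)) ≠ ⊤ := by
    intro q hq
    have hq2 := (mem_momentClass_iff hφ hL).1 hq
    exact ⟨hq2.1, negMean_log_ne_top hq2.1 (hq2.2.2 γ₀).1 hst.integrable_exp_neg⟩
  refine ⟨?_, hp.mem, ?_, fun q hq => Or.inr (hneg q hq).2, fun q hq => ?_, fun q hq heq => ?_⟩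
  · intro q hq r hr a b ha hb hab
    exact convex_comb_mem_momentClass hφ hL hq hr ha hb hab
  · rw [hp.entropy_eq]; exact EReal.bot_lt_coe _
  · by_cases hi : Integrable (fun x => Real.log (q x) * q x)
    · rw [hp.entropy_eq, entropy_eq_neg_logMean hi, EReal.coe_le_coe_iff]
      linarith [hp.le q hq hi]
    · rw [entropy_eq_bot (hneg q hq).1 (hneg q hq).2 hi]
      exact bot_le
  · have hi : Integrable (fun x => Real.log (q x) * q x) := by
      by_contra hi
      rw [entropy_eq_bot (hneg q hq).1 (hneg q hq).2 hi, hp.entropy_eq] at heq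
      exact (EReal.bot_lt_coe _).ne heq
    rw [hp.entropy_eq, entropy_eq_neg_logMean hi, EReal.coe_eq_coe_iff, neg_inj] at heq
    exact hp.ae_eq hφ hL hst hq hi heq

theorem IsLogMeanMinimizer.exists_hasExponentialForm [Fintype Γ]
    (hφ : ∀ γ, AEMeasurable (φ γ) volume) {L : ℝ}
    (hL : ∀ γ, ∀ᵐ x ∂(volume : Measure (Space d)), L ≤ φ γ x) {γ₀ : Γ} (hst : IsStable (φ γ₀))
    (hp : IsLogMeanMinimizer S φ u p) :
    ∃ (lam : Γ → ℝ) (α : ℝ), HasExponentialForm S φ u p lam α := by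
  have hp2 := (mem_momentClass_iff hφ hL).1 hp.mem
  obtain ⟨lam, hlam, hact, hlog⟩ := hp.exists_multipliers hφ hL hst
  set E : Γ → ℝ := fun γ => ∫ y, φ γ y * p y with hE
  -- The constant term of $-\ln p$ on the support. Since `p` has mass $1$, it is also the logarithm
  -- of the normalizing integral.
  set α : ℝ := -logMean p - ∑ γ, lam γ * E γ with hα
  have hmean : ∀ γ, mean p (φ γ) = (E γ : EReal) := fun γ => mean_eq_integral (hp2.2.2 γ).1
  have hform : ∀ᵐ x ∂(volume : Measure (Space d)), x ∈ Function.support p →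
      p x = Real.exp (-α - ∑ γ, lam γ * φ γ x) := by
    filter_upwards [hlog, hp2.1.nonneg] with x hx hx0 hxs
    have hpos : 0 < p x := lt_of_le_of_ne hx0 (Ne.symm hxs)
    rw [← Real.exp_log hpos, hx hxs, hα]
    simp only [mul_sub, Finset.sum_sub_distrib]
    congr 1
    ring
  have hsm : NullMeasurableSet (Function.support p) (volume : Measure (Space d)) :=
    hp2.1.integrable.aestronglyMeasurable.aemeasurable.nullMeasurable
      (measurableSet_singleton 0).compl
  have hpα : ∀ᵐ x ∂(volume : Measure (Space d)), x ∈ Function.support p →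
      Real.exp (-∑ γ, lam γ * φ γ x) = Real.exp α * p x := by
    filter_upwards [hform] with x hx hxs
    rw [hx hxs, ← Real.exp_add]
    congr 1
    ring
  have hpα' := (ae_restrict_iff'₀ hsm).2 hpα
  have hint : ∫ x in Function.support p, Real.exp (-∑ γ, lam γ * φ γ x) = Real.exp α := by
    rw [integral_congr_ae hpα', integral_const_mul, setIntegral_support, hp2.1.integral_eq_one,
      mul_one]
  have hsum : ∑ γ, lam γ * E γ = ∑ γ, u γ * lam γ := by
    refine Finset.sum_congr rfl fun γ _ => ?_
    rcases hact γ with h | h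
    · simp [h]
    · rw [mul_comm]; simp only [hE, h]
  have hcoe : ∀ c : Γ → ℝ, ∑ γ, ((c γ : ℝ) : EReal) = ((∑ γ, c γ : ℝ) : EReal) := fun c =>
    (map_sum (⟨⟨fun x : ℝ => (x : EReal), EReal.coe_zero⟩, EReal.coe_add⟩ : ℝ →+ EReal) c _).symm
  refine ⟨lam, α, ?_, ?_, ?_, ?_, ?_, hlam, ?_, ?_, ?_⟩
  · filter_upwards [hform] with x hx
    by_cases hxs : x ∈ Function.support p
    · rw [Set.indicator_of_mem hxs, hx hxs]
    · rw [Set.indicator_of_notMem hxs]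
      simpa using hxs
  · exact hp.mem.2.1
  · intro q hq _ hbot
    have hq2 := (mem_momentClass_iff hφ hL).1 hq
    have hi : Integrable (fun x => Real.log (q x) * q x) := by
      by_contra hi
      rw [entropy_eq_bot hq2.1
        (negMean_log_ne_top hq2.1 (hq2.2.2 γ₀).1 hst.integrable_exp_neg) hi] at hbot
      exact lt_irrefl _ hbot
    have hz : (fun x => (S \ Function.support p).indicator (fun _ => (1 : ℝ)) x * q x)
        =ᵐ[volume] fun _ => 0 := by
      filter_upwards [hp.eq_zero_of_eq_zero hφ hL hst hq hi] with x hx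
      by_cases hxs : x ∈ Function.support p
      · simp [Set.indicator_of_notMem (fun h : x ∈ S \ Function.support p => h.2 hxs)]
      · rw [hx (by simpa using hxs), mul_zero]
    rw [mean_eq_integral ((integrable_zero _ _ _).congr hz.symm), integral_congr_ae hz]
    simp
  · exact ((hp2.1.integrable.const_mul (Real.exp α)).integrableOn).congr (EventuallyEq.symm hpα')
  · rw [hint, Real.log_exp]
  · refine Finset.sum_eq_zero fun γ _ => ?_
    rw [hmean]
    rcases hact γ with h | h
    · simp [h]
    · have : E γ = u γ := h
      rw [this, ← EReal.coe_sub, sub_self]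
      simp
  · simp only [hmean, ← EReal.coe_mul]
    rw [hcoe, ← EReal.coe_add, hp.entropy_eq, EReal.coe_eq_coe_iff, hα]
    ring
  · rw [hp.entropy_eq, EReal.coe_eq_coe_iff, ← hsum, hα]
    ring

end Maxent

theorem corollary1 {d : ℕ} {Γ : Type*} [Fintype Γ]
    (S : Set (Maxent.Space d)) (hS : IsClosed S) (hSvol : volume S ≠ 0)
    (φ : Γ → Maxent.Space d → ℝ) (hφ : ∀ γ, AEMeasurable (φ γ) volume) (u : Γ → ℝ)
    (L : ℝ) (hL : ∀ γ, ∀ᵐ x ∂(volume : Measure (Maxent.Space d)), L ≤ φ γ x)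
    (hΩ : (Maxent.momentClass S φ u).Nonempty)
    (hC : volume (⋂ γ, {x | x ∈ S ∧ φ γ x ≤ u γ}) ≠ 0)
    (hstable : ∃ γ₀, Maxent.IsStable (φ γ₀)) :
    ∃ p : Maxent.Space d → ℝ,
      Maxent.IsMaxent (Maxent.momentClass S φ u) p ∧
      (∃ r : ℝ, Maxent.entropy p = (r : EReal)) ∧
      ∃ (lam : Γ → ℝ) (α : ℝ), Maxent.HasExponentialForm S φ u p lam α := by
  obtain ⟨γ₀, hst⟩ := hstable
  obtain ⟨p, hp⟩ := Maxent.exists_isLogMeanMinimizer hφ hL hst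
    (Maxent.exists_uniform_mem_momentClass hS hφ hL hC hst)
  exact ⟨p, hp.isMaxent hφ hL hst, ⟨_, hp.entropy_eq⟩, hp.exists_hasExponentialForm hφ hL hst⟩
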